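/- Let $k$ be a field, $V$ a finite-dimensional $k$-vector space and $b\colon V\times V\to k$ a symmetric $k$-bilinear form that is anisotropic, i.e. $b(v,v)=0\Leftrightarrow v=0$. Let $U(b)$ be the group of $k$-linear automorphisms of $V$ that preserve $b$. For a subspace $U\subseteq V$ put $U^{*}=\{v\in V : b(u,v)=0 \text{ for all } u\in U\}$; then $V=U\oplus U^{*}$, and $\pi_U$ denotes the projection of $V$ onto $U$ along $U^{*}$. Let $V[t,t^{-1}]=k[t,t^{-1}]\otimes_k V$, write its elements as finite sums $v=\sum_i t^i v_i$ with $v_i\in V$, and put $$\tilde b(v,w)=\sum_{n\in\mathbb Z} t^n\Big(\sum_{i\in\mathbb Z} b(v_{i-n},w_i)\Big)\in k[t,t^{-1}].$$ Let $\mathrm{PU}(b)$ be the group of all $k[t,t^{-1}]$-linear automorphisms $\varphi$ of $V[t,t^{-1}]$ with $\tilde b(\varphi(v),\varphi(w))=\tilde b(v,w)$ for all $v,w$. Every $k[t,t^{-1}]$-linear endomorphism of $V[t,t^{-1}]$ has an expansion $\varphi=\sum_i t^i\varphi_i$ with $\varphi_i\in\mathrm{End}_k(V)$; let $\mathrm{PU}(b)^{-}$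 be the set of those $\varphi\in \mathrm{PU}(b)$ with $\varphi_i=0$ for all $i>0$. Regard $U(b)$ as a subgroup of $\mathrm{PU}(b)$ (the constants $t^0h$), and for a subspace $U\subseteq V$ let $$p_U=t^{-1}\pi_{U^{*}}+\pi_U .$$ Then for every $p\in \mathrm{PU}(b)^{-}$ there are a unique $n\ge 0$, unique proper subspaces $U_1,\dots,U_n\subsetneq V$ and a unique $h\in U(b)$ such that $U_i^{*}+U_{i+1}=V$ for $1\le i<n$ and $$p=p_{U_1}p_{U_2}\cdots p_{U_n}\,h .$$ -/

import Mathlib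

open scoped TensorProduct LaurentPolynomial

noncomputable section

namespace Paraunitary

variable {k V : Type*} [Field k] [AddCommGroup V] [Module k V]

/-- `b` is anisotropic: `b(v, v) = 0` exactly when `v = 0`. -/
def IsAnisotropic (b : LinearMap.BilinForm k V) : Prop :=
  ∀ v : V, b v v = 0 ↔ v = 0

/-- The unitary group `U(b)`: the `k`-linear automorphisms of `V` that preserve `b`. -/
def unitaryGroup (b : LinearMap.BilinForm k V) : Subgroup (V ≃ₗ[k] V) where
  carrier := {φ | ∀ v w, b (φ v) (φ w) = b v w}
  one_mem' := fun _ _ => rfl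
  mul_mem' := fun {φ ψ} hφ hψ v w => (hφ (ψ v) (ψ w)).trans (hψ v w)
  inv_mem' := fun {φ} hφ v w => by
    have h := hφ (φ.symm v) (φ.symm w)
    rw [LinearEquiv.apply_symm_apply, LinearEquiv.apply_symm_apply] at h
    exact h.symm

variable (k V) in
/-- `V[t, t⁻¹] = k[t, t⁻¹] ⊗ V`. -/
abbrev LaurentModule : Type _ := k[T;T⁻¹] ⊗[k] V

variable (k V) in
/-- The expansion of `v ∈ V[t, t⁻¹]` as a finite sum `∑ tⁱ vᵢ` with `vᵢ ∈ V`: the finitely supported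
family of the coordinates `vᵢ`. -/
def coord : LaurentModule k V ≃ₗ[k] (ℤ →₀ V) :=
  (TensorProduct.congr (AddMonoidAlgebra.coeffLinearEquiv k) (LinearEquiv.refl k V)).trans
    (TensorProduct.finsuppScalarLeft k V ℤ)

/-- The extension of `b` to `V[t, t⁻¹]`:
for `v = ∑ tⁱ vᵢ` and `w = ∑ tʲ wⱼ` it is `∑ᵢ ∑ⱼ b(vᵢ, wⱼ) tʲ⁻ⁱ`, whose coefficient at `tⁿ` is
`∑ᵢ b(vᵢ₋ₙ, wᵢ)`. -/
def laurentForm (b : LinearMap.BilinForm k V) (v w : LaurentModule k V) : k[T;T⁻¹] :=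
  (coord k V v).sum fun i x => (coord k V w).sum fun j y =>
    LaurentPolynomial.C (b x y) * LaurentPolynomial.T (j - i)

/-- The paraunitary group `PU(b)`: the `k[t, t⁻¹]`-linear automorphisms of `V[t, t⁻¹]` that
preserve the extended form. -/
def paraunitaryGroup (b : LinearMap.BilinForm k V) :
    Subgroup (LaurentModule k V ≃ₗ[k[T;T⁻¹]] LaurentModule k V) where
  carrier := {φ | ∀ v w, laurentForm b (φ v) (φ w) = laurentForm b v w}
  one_mem' := fun _ _ => rfl
  mul_mem' := fun {φ ψ} hφ hψ v w => (hφ (ψ v) (ψ w)).trans (hψ v w)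
  inv_mem' := fun {φ} hφ v w => by
    have h := hφ (φ.symm v) (φ.symm w)
    rw [LinearEquiv.apply_symm_apply, LinearEquiv.apply_symm_apply] at h
    exact h.symm

/-- The coefficient `φᵢ ∈ End V` of an endomorphism `φ = ∑ tⁱ φᵢ` of `V[t, t⁻¹]`:
`φᵢ(v)` is the `i`-th coordinate of `φ(v)`, for `v ∈ V`. -/
def laurentCoeff (φ : Module.End k[T;T⁻¹] (LaurentModule k V)) (i : ℤ) : Module.End k V :=
  Finsupp.lapply i ∘ₗ (coord k V).toLinearMap ∘ₗ φ.restrictScalars k ∘ₗ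
    TensorProduct.mk k k[T;T⁻¹] V 1

/-- `PU(b)⁻`: the elements of `PU(b)` whose Laurent expansion has no positive powers of `t`. -/
def paraunitaryNeg (b : LinearMap.BilinForm k V) : Set (paraunitaryGroup b) :=
  {p | ∀ i : ℤ, 0 < i → laurentCoeff (p.1 : Module.End k[T;T⁻¹] (LaurentModule k V)) i = 0}

/-- The constant endomorphism `t⁰ φ` of `V[t, t⁻¹]` given by an endomorphism `φ` of `V`. -/
abbrev constEnd (φ : Module.End k V) : Module.End k[T;T⁻¹] (LaurentModule k V) :=
  LinearMap.baseChange k[T;T⁻¹] φ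

/-- For an anisotropic form, `V = U ⊕ U*`, where `U* = {v | ∀ u ∈ U, b(u, v) = 0}`. -/
theorem isCompl_orthogonal [FiniteDimensional k V] {b : LinearMap.BilinForm k V}
    (hs : b.IsSymm) (ha : IsAnisotropic b) (U : Submodule k V) :
    IsCompl U (b.orthogonal U) :=
  (LinearMap.BilinForm.isCompl_orthogonal_iff_disjoint hs.isRefl).2 <|
    Submodule.disjoint_def.2 fun x hx hx' => (ha x).1 (hx' x hx)

/-- `p_U = t⁻¹ π_{U*} + π_U`, where `π_U` and `π_{U*}` are the projections of `V = U ⊕ U*` onto `U`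
along `U*` and onto `U*` along `U`. -/
def elementary [FiniteDimensional k V] {b : LinearMap.BilinForm k V}
    (hs : b.IsSymm) (ha : IsAnisotropic b) (U : Submodule k V) :
    Module.End k[T;T⁻¹] (LaurentModule k V) :=
  (LaurentPolynomial.T (-1) : k[T;T⁻¹]) •
      constEnd (Submodule.projection (b.orthogonal U) U (isCompl_orthogonal hs ha U).symm) +
    constEnd (Submodule.projection U (b.orthogonal U) (isCompl_orthogonal hs ha U))

end Paraunitary

end

noncomputable section

namespace Paraunitary

variable {k V : Type*} [Field k] [AddCommGroup V] [Module k V]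

open LaurentPolynomial (T C)

/-! ### Coordinates on `V[t, t⁻¹]` -/

/-! Both halves rest on the image of the constant coefficient `φ₀`. Uniqueness: if `ψ` has no
positive powers, `(p_U ψ)₀ = π_U ψ₀`, and `π_U(W) = U` exactly when `U* + W = V`
(`proj_map_eq_self_iff`). So the chain condition makes `U₁` the image of `p₀` (all of `V` when `n =
0`); cancel `p_{U₁}` and induct. Existence: let `φ` be supported in degrees `-m, …, 0` with `m > 0`.
The `t⁻ᵐ` coefficient of the preserved form gives `im φ₀ ⊥ im φ₋ₘ` (`PreservesForm.lowest`). With `U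
= im φ₀`, multiplication by `p_U⁻¹ = t π_{U*} + π_U` thus creates no `t¹` term and kills the `t⁻ᵐ`
term, and induction on `m` applies. -/

theorem coord_tmul (f : k[T;T⁻¹]) (v : V) (i : ℤ) :
    coord k V (f ⊗ₜ v) i = f.coeff i • v := by
  simp only [coord, LinearEquiv.trans_apply, TensorProduct.congr_tmul,
    TensorProduct.finsuppScalarLeft_apply_tmul_apply, LinearEquiv.refl_apply]
  rfl

theorem coord_T_tmul (n : ℤ) (v : V) :
    coord k V (T n ⊗ₜ v) = Finsupp.single n v := by
  ext i
  rw [coord_tmul, LaurentPolynomial.T_apply, Finsupp.single_apply]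
  split_ifs <;> simp

theorem LaurentModule.induction_on {motive : LaurentModule k V → Prop} (x : LaurentModule k V)
    (add : ∀ x y, motive x → motive y → motive (x + y))
    (tmul : ∀ (n : ℤ) (v : V), motive (T n ⊗ₜ v)) : motive x := by
  induction x using TensorProduct.induction_on with
  | zero => simpa using tmul 0 0
  | add x y hx hy => exact add x y hx hy
  | tmul f v =>
    induction f using LaurentPolynomial.induction_on' with
    | add f g hf hg => rw [TensorProduct.add_tmul]; exact add _ _ hf hg
    | C_mul_T n a =>
      rw [← LaurentPolynomial.smul_eq_C_mul, TensorProduct.smul_tmul]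
      exact tmul n _

theorem T_smul_T_tmul (m n : ℤ) (v : V) :
    (T m : k[T;T⁻¹]) • (T n ⊗ₜ[k] v : LaurentModule k V) = T (m + n) ⊗ₜ v := by
  rw [TensorProduct.smul_tmul', smul_eq_mul, ← LaurentPolynomial.T_add]

theorem coord_T_smul (n : ℤ) (x : LaurentModule k V) (i : ℤ) :
    coord k V ((T n : k[T;T⁻¹]) • x) i = coord k V x (i - n) := by
  induction x using LaurentModule.induction_on with
  | add x y hx hy => simp only [smul_add, map_add, Finsupp.add_apply, hx, hy]
  | tmul m v =>
    rw [T_smul_T_tmul, coord_T_tmul, coord_T_tmul, Finsupp.single_apply, Finsupp.single_apply]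
    congr 1
    exact propext ⟨fun h => by omega, fun h => by omega⟩

theorem coord_constEnd (A : Module.End k V) (x : LaurentModule k V) (i : ℤ) :
    coord k V (constEnd A x) i = A (coord k V x i) := by
  induction x using LaurentModule.induction_on with
  | add x y hx hy => simp only [map_add, Finsupp.add_apply, hx, hy]
  | tmul m v => simp only [LinearMap.baseChange_tmul, coord_tmul, map_smul]

/-! ### Coefficients of endomorphisms -/

theorem laurentCoeff_apply (φ : Module.End k[T;T⁻¹] (LaurentModule k V)) (i : ℤ) (v : V) :
    laurentCoeff φ i v = coord k V (φ (1 ⊗ₜ v)) i := rfl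

/-- By linearity over `k[t, t⁻¹]`, an endomorphism is determined by its values on `1 ⊗ V`. -/
theorem laurentCoeff_ext {φ ψ : Module.End k[T;T⁻¹] (LaurentModule k V)}
    (h : ∀ i, laurentCoeff φ i = laurentCoeff ψ i) : φ = ψ := by
  refine TensorProduct.AlgebraTensorModule.curry_injective (LinearMap.ext_ring ?_)
  ext v
  apply (coord k V).injective
  ext i
  exact LinearMap.congr_fun (h i) v

theorem laurentCoeff_add (φ ψ : Module.End k[T;T⁻¹] (LaurentModule k V)) (i : ℤ) :
    laurentCoeff (φ + ψ) i = laurentCoeff φ i + laurentCoeff ψ i := by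
  ext v
  simp [laurentCoeff_apply]

theorem laurentCoeff_T_smul (n : ℤ) (φ : Module.End k[T;T⁻¹] (LaurentModule k V)) (i : ℤ) :
    laurentCoeff ((T n : k[T;T⁻¹]) • φ) i = laurentCoeff φ (i - n) := by
  ext v
  rw [laurentCoeff_apply, LinearMap.smul_apply, coord_T_smul, laurentCoeff_apply]

theorem laurentCoeff_constEnd_mul (A : Module.End k V)
    (φ : Module.End k[T;T⁻¹] (LaurentModule k V)) (i : ℤ) :
    laurentCoeff (constEnd A * φ) i = A * laurentCoeff φ i := by
  ext v
  rw [laurentCoeff_apply, Module.End.mul_apply, coord_constEnd, Module.End.mul_apply,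
    laurentCoeff_apply]

theorem laurentCoeff_constEnd (A : Module.End k V) (i : ℤ) :
    laurentCoeff (constEnd A) i = if i = 0 then A else 0 := by
  ext v
  rw [laurentCoeff_apply, LinearMap.baseChange_tmul, coord_tmul, ← LaurentPolynomial.T_zero,
    LaurentPolynomial.T_apply]
  by_cases h : i = 0
  · simp [h]
  · simp [h, Ne.symm h]

theorem constEnd_injective :
    Function.Injective (constEnd : Module.End k V → Module.End k[T;T⁻¹] (LaurentModule k V)) := by
  intro A B h
  simpa [laurentCoeff_constEnd] using congrArg (laurentCoeff · 0) h

/-! ### The extended form -/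

variable {b : LinearMap.BilinForm k V}

theorem laurentForm_add_left (x y z : LaurentModule k V) :
    laurentForm b (x + y) z = laurentForm b x z + laurentForm b y z := by
  unfold laurentForm
  rw [map_add, Finsupp.sum_add_index']
  · intro i; simp
  · intro i u v; simp [← Finsupp.sum_add, add_mul]

theorem laurentForm_add_right (x y z : LaurentModule k V) :
    laurentForm b x (y + z) = laurentForm b x y + laurentForm b x z := by
  unfold laurentForm
  rw [map_add, ← Finsupp.sum_add]
  refine Finsupp.sum_congr fun i _ => Finsupp.sum_add_index' ?_ ?_
  · intro j; simp
  · intro j u v; simp [add_mul]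

theorem laurentForm_T_tmul (i j : ℤ) (v w : V) :
    laurentForm b (T i ⊗ₜ v) (T j ⊗ₜ w) = C (b v w) * T (j - i) := by
  unfold laurentForm
  rw [coord_T_tmul, coord_T_tmul, Finsupp.sum_single_index (by simp),
    Finsupp.sum_single_index (by simp)]

/-- If `x` and `y` only involve `t⁻ᵐ, …, t⁰`, the lowest coefficient of the form at `(x, y)` pairs
the coordinate of `x` at `t⁰` with that of `y` at `t⁻ᵐ`. -/
theorem laurentForm_coeff_lowest {m : ℕ} {x y : LaurentModule k V}
    (hx : ∀ i, i ∉ Finset.Icc (-m : ℤ) 0 → coord k V x i = 0)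
    (hy : ∀ i, i ∉ Finset.Icc (-m : ℤ) 0 → coord k V y i = 0) :
    (laurentForm b x y).coeff (-m) = b (coord k V x 0) (coord k V y (-m)) := by
  have hsub : ∀ {z : LaurentModule k V}, (∀ i, i ∉ Finset.Icc (-m : ℤ) 0 → coord k V z i = 0) →
      (coord k V z).support ⊆ Finset.Icc (-m : ℤ) 0 := fun hz i hi => by
    by_contra h
    exact Finsupp.mem_support_iff.1 hi (hz i h)
  have hcoeff : ∀ (a : k) (n : ℤ), (C a * T n : k[T;T⁻¹]).coeff (-m) = if n = -m then a else 0 :=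
    fun a n => by
      rw [← LaurentPolynomial.single_eq_C_mul_T, AddMonoidAlgebra.coeff_single,
        Finsupp.single_apply]
  unfold laurentForm
  rw [Finsupp.sum_of_support_subset _ (hsub hx) _ (by simp), AddMonoidAlgebra.coeff_sum,
    Finsupp.finsetSum_apply, Finset.sum_eq_single 0]
  · rw [Finsupp.sum_of_support_subset _ (hsub hy) _ (by simp), AddMonoidAlgebra.coeff_sum,
      Finsupp.finsetSum_apply, Finset.sum_eq_single (-m : ℤ)]
    · simp [hcoeff]
    · intro j _ hj
      rw [hcoeff, if_neg (by omega)]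
    · intro h
      simp at h
  · intro i hi hi0
    rw [Finsupp.sum_of_support_subset _ (hsub hy) _ (by simp), AddMonoidAlgebra.coeff_sum,
      Finsupp.finsetSum_apply]
    refine Finset.sum_eq_zero fun j hj => ?_
    rw [Finset.mem_Icc] at hi hj
    -- With `j ≥ -m` and `i < 0`, the exponent `j - i` exceeds `-m`.
    rw [hcoeff, if_neg (by omega)]
  · intro h
    simp at h

/-- An endomorphism of `V[t, t⁻¹]` preserves the extended form. -/
def PreservesForm (b : LinearMap.BilinForm k V)
    (φ : Module.End k[T;T⁻¹] (LaurentModule k V)) : Prop :=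
  ∀ x y, laurentForm b (φ x) (φ y) = laurentForm b x y

theorem PreservesForm.mul {φ ψ : Module.End k[T;T⁻¹] (LaurentModule k V)}
    (hφ : PreservesForm b φ) (hψ : PreservesForm b ψ) : PreservesForm b (φ * ψ) :=
  fun x y => (hφ (ψ x) (ψ y)).trans (hψ x y)

/-- The form at `(1 ⊗ v, 1 ⊗ w)` is the constant `b v w`, so its coefficient at `t⁻ᵐ` vanishes
unless `m = 0`. -/
theorem PreservesForm.lowest {φ : Module.End k[T;T⁻¹] (LaurentModule k V)}
    (hφ : PreservesForm b φ) {m : ℕ} (hm : ∀ i, i ∉ Finset.Icc (-m : ℤ) 0 → laurentCoeff φ i = 0)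
    (v w : V) :
    b (laurentCoeff φ 0 v) (laurentCoeff φ (-m) w) = if m = 0 then b v w else 0 := by
  have h : ∀ u : V, ∀ i, i ∉ Finset.Icc (-m : ℤ) 0 → coord k V (φ (1 ⊗ₜ u)) i = 0 :=
    fun u i hi => LinearMap.congr_fun (hm i hi) u
  rw [laurentCoeff_apply, laurentCoeff_apply, ← laurentForm_coeff_lowest (h v) (h w), hφ,
    ← LaurentPolynomial.T_zero, laurentForm_T_tmul, sub_self, LaurentPolynomial.T_zero, mul_one,
    LaurentPolynomial.C_apply]
  simp

theorem preservesForm_T_smul_add (n : ℤ) {A B : Module.End k V}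
    (hAB : ∀ v w, b (A v) (B w) = 0) (hBA : ∀ v w, b (B v) (A w) = 0)
    (hadd : ∀ v w, b (A v) (A w) + b (B v) (B w) = b v w) :
    PreservesForm b ((T n : k[T;T⁻¹]) • constEnd A + constEnd B) := by
  intro x y
  induction x using LaurentModule.induction_on with
  | add x x' hx hx' => rw [map_add, laurentForm_add_left, laurentForm_add_left, hx, hx']
  | tmul i v =>
    induction y using LaurentModule.induction_on with
    | add y y' hy hy' => rw [map_add, laurentForm_add_right, laurentForm_add_right, hy, hy']
    | tmul j w =>
      simp only [LinearMap.add_apply, LinearMap.smul_apply, LinearMap.baseChange_tmul,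
        T_smul_T_tmul, laurentForm_add_left, laurentForm_add_right, laurentForm_T_tmul, hAB, hBA]
      rw [← hadd v w, map_add, add_sub_add_left_eq_sub]
      simp [add_mul]

/-! ### The elementary factors and their inverses -/

variable [FiniteDimensional k V] (hs : b.IsSymm) (ha : IsAnisotropic b)

/-- The projection of `V = U ⊕ U*` onto `U` along `U*`. -/
abbrev proj (U : Submodule k V) : Module.End k V :=
  Submodule.projection U (b.orthogonal U) (isCompl_orthogonal hs ha U)

/-- The projection of `V = U ⊕ U*` onto `U*` along `U`. -/
abbrev projOrthogonal (U : Submodule k V) : Module.End k V :=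
  Submodule.projection (b.orthogonal U) U (isCompl_orthogonal hs ha U).symm

/-- The inverse `t π_{U*} + π_U` of `p_U`. -/
def elementaryInv (U : Submodule k V) : Module.End k[T;T⁻¹] (LaurentModule k V) :=
  (T 1 : k[T;T⁻¹]) • constEnd (projOrthogonal hs ha U) + constEnd (proj hs ha U)

theorem proj_mul_self (U : Submodule k V) : proj hs ha U * proj hs ha U = proj hs ha U :=
  Submodule.isIdempotentElem_projection _

theorem projOrthogonal_mul_self (U : Submodule k V) :
    projOrthogonal hs ha U * projOrthogonal hs ha U = projOrthogonal hs ha U :=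
  Submodule.isIdempotentElem_projection _

theorem proj_mul_projOrthogonal (U : Submodule k V) :
    proj hs ha U * projOrthogonal hs ha U = 0 := by
  ext v
  exact Submodule.projection_apply_of_mem_right _ (Submodule.projection_apply_mem _ v)

theorem projOrthogonal_mul_proj (U : Submodule k V) :
    projOrthogonal hs ha U * proj hs ha U = 0 := by
  ext v
  exact Submodule.projection_apply_of_mem_right _ (Submodule.projection_apply_mem _ v)

theorem projOrthogonal_add_proj (U : Submodule k V) :
    projOrthogonal hs ha U + proj hs ha U = 1 :=
  Submodule.projection_add_projection_eq_id _

theorem laurentCoeff_elementary_mul (U : Submodule k V)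
    (φ : Module.End k[T;T⁻¹] (LaurentModule k V)) (i : ℤ) :
    laurentCoeff (elementary hs ha U * φ) i =
      projOrthogonal hs ha U * laurentCoeff φ (i + 1) + proj hs ha U * laurentCoeff φ i := by
  rw [elementary, add_mul, smul_mul_assoc, laurentCoeff_add, laurentCoeff_T_smul,
    laurentCoeff_constEnd_mul, laurentCoeff_constEnd_mul, sub_neg_eq_add]

theorem laurentCoeff_elementaryInv_mul (U : Submodule k V)
    (φ : Module.End k[T;T⁻¹] (LaurentModule k V)) (i : ℤ) :
    laurentCoeff (elementaryInv hs ha U * φ) i =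
      projOrthogonal hs ha U * laurentCoeff φ (i - 1) + proj hs ha U * laurentCoeff φ i := by
  rw [elementaryInv, add_mul, smul_mul_assoc, laurentCoeff_add, laurentCoeff_T_smul,
    laurentCoeff_constEnd_mul, laurentCoeff_constEnd_mul]

/-- The trailing factor `φ` lets the coefficient formulas for products apply directly. -/
theorem elementary_mul_elementaryInv_mul (U : Submodule k V)
    (φ : Module.End k[T;T⁻¹] (LaurentModule k V)) :
    elementary hs ha U * (elementaryInv hs ha U * φ) = φ := by
  refine laurentCoeff_ext fun i => ?_
  simp only [laurentCoeff_elementary_mul, laurentCoeff_elementaryInv_mul, mul_add]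
  simp only [← mul_assoc, projOrthogonal_mul_self, proj_mul_self, proj_mul_projOrthogonal,
    projOrthogonal_mul_proj, zero_mul, add_zero, zero_add, add_sub_cancel_right]
  rw [← add_mul, projOrthogonal_add_proj, one_mul]

theorem elementaryInv_mul_elementary_mul (U : Submodule k V)
    (φ : Module.End k[T;T⁻¹] (LaurentModule k V)) :
    elementaryInv hs ha U * (elementary hs ha U * φ) = φ := by
  refine laurentCoeff_ext fun i => ?_
  simp only [laurentCoeff_elementary_mul, laurentCoeff_elementaryInv_mul, mul_add]
  simp only [← mul_assoc, projOrthogonal_mul_self, proj_mul_self, proj_mul_projOrthogonal,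
    projOrthogonal_mul_proj, zero_mul, add_zero, zero_add, sub_add_cancel]
  rw [← add_mul, projOrthogonal_add_proj, one_mul]

theorem preservesForm_elementaryInv (U : Submodule k V) :
    PreservesForm b (elementaryInv hs ha U) := by
  have hBA : ∀ v w, b (proj hs ha U v) (projOrthogonal hs ha U w) = 0 := fun v w =>
    Submodule.projection_apply_mem (isCompl_orthogonal hs ha U).symm w _
      (Submodule.projection_apply_mem _ v)
  have hAB : ∀ v w, b (projOrthogonal hs ha U v) (proj hs ha U w) = 0 := fun v w =>
    (hs.eq _ _).symm.trans (hBA w v)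
  refine preservesForm_T_smul_add 1 hAB hBA fun v w => ?_
  have h : ∀ u, projOrthogonal hs ha U u + proj hs ha U u = u := fun u =>
    LinearMap.congr_fun (projOrthogonal_add_proj hs ha U) u
  conv_rhs => rw [← h v, ← h w]
  simp only [map_add, LinearMap.add_apply, hAB, hBA, add_zero, zero_add]

/-- The kernel of `π_U` is `U*`, so `W` maps onto `U` exactly when it meets every coset of `U*`. -/
theorem proj_map_eq_self_iff (U W : Submodule k V) :
    W.map (proj hs ha U) = U ↔ b.orthogonal U ⊔ W = ⊤ := by
  have hdiff : ∀ v, v - proj hs ha U v ∈ b.orthogonal U := Submodule.sub_projection_mem _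
  constructor
  · refine fun h => eq_top_iff.2 fun v _ => ?_
    have hv : proj hs ha U v ∈ W.map (proj hs ha U) :=
      h.symm ▸ Submodule.projection_apply_mem _ v
    obtain ⟨w, hw, hwv⟩ := hv
    refine Submodule.mem_sup.2 ⟨v - w, ?_, w, hw, sub_add_cancel v w⟩
    have := sub_mem (hdiff v) (hdiff w)
    rwa [hwv, sub_sub_sub_cancel_right] at this
  · refine fun h => le_antisymm ?_ fun u hu => ?_
    · rintro _ ⟨w, -, rfl⟩
      exact Submodule.projection_apply_mem _ w
    · obtain ⟨v, hv, w, hw, rfl⟩ := Submodule.mem_sup.1 (h.symm ▸ Submodule.mem_top : u ∈ _)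
      refine ⟨w, hw, ?_⟩
      rw [← Submodule.projection_apply_of_mem_left (isCompl_orthogonal hs ha U) hu, map_add,
        Submodule.projection_apply_of_mem_right _ hv, zero_add]

/-! ### Factorizations -/

/-- The product `p_{U₁} ⋯ p_{Uₙ} h`. -/
def elementaryProd (l : List (Submodule k V)) (h : Module.End k V) :
    Module.End k[T;T⁻¹] (LaurentModule k V) :=
  (l.map (elementary hs ha)).prod * constEnd h

theorem elementaryProd_cons (U : Submodule k V) (l : List (Submodule k V)) (h : Module.End k V) :
    elementaryProd hs ha (U :: l) h = elementary hs ha U * elementaryProd hs ha l h := by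
  simp [elementaryProd, mul_assoc]

theorem elementaryProd_nil (h : Module.End k V) : elementaryProd hs ha [] h = constEnd h := by
  simp [elementaryProd]

theorem laurentCoeff_elementaryProd_of_pos (l : List (Submodule k V)) (h : Module.End k V)
    {i : ℤ} (hi : 0 < i) : laurentCoeff (elementaryProd hs ha l h) i = 0 := by
  induction l generalizing i with
  | nil => rw [elementaryProd_nil, laurentCoeff_constEnd, if_neg hi.ne']
  | cons U l ih =>
    rw [elementaryProd_cons, laurentCoeff_elementary_mul, ih hi, ih (by omega)]
    simp

/-- If `ψ` has no positive powers of `t`, then `im (p_U ψ)₀ = π_U (im ψ₀)`. -/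
theorem range_laurentCoeff_elementary_mul_zero (U : Submodule k V)
    {ψ : Module.End k[T;T⁻¹] (LaurentModule k V)} (hψ : ∀ i, 0 < i → laurentCoeff ψ i = 0) :
    LinearMap.range (laurentCoeff (elementary hs ha U * ψ) 0) =
      (LinearMap.range (laurentCoeff ψ 0)).map (proj hs ha U) := by
  rw [laurentCoeff_elementary_mul, hψ _ (by omega), mul_zero, zero_add, Module.End.mul_eq_comp,
    LinearMap.range_comp]

/-- The first subspace of a factorization is the image of the constant coefficient. -/
theorem range_laurentCoeff_elementaryProd {l : List (Submodule k V)}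
    (hl : l.IsChain (fun U W => b.orthogonal U ⊔ W = ⊤)) (h : unitaryGroup b) :
    LinearMap.range (laurentCoeff (elementaryProd hs ha l (h.1 : Module.End k V)) 0) =
      l.headD ⊤ := by
  induction l with
  | nil => rw [elementaryProd_nil, laurentCoeff_constEnd, if_pos rfl]; exact LinearEquiv.range h.1
  | cons U l ih =>
    rw [List.isChain_cons] at hl
    rw [elementaryProd_cons, range_laurentCoeff_elementary_mul_zero _ _ _
      fun i hi => laurentCoeff_elementaryProd_of_pos hs ha l _ hi, ih hl.2]
    refine (proj_map_eq_self_iff hs ha U _).2 ?_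
    -- The default `⊤` is the image of the automorphism `h`, so the last factor needs no chain
    -- condition.
    cases l with
    | nil => exact sup_top_eq _
    | cons W l => exact hl.1 W rfl

/-- `(l, h)` satisfies the conditions imposed on a factorization of `φ`. -/
def IsFactorization (φ : Module.End k[T;T⁻¹] (LaurentModule k V))
    (x : List (Submodule k V) × unitaryGroup b) : Prop :=
  (∀ U ∈ x.1, U ≠ ⊤) ∧ x.1.IsChain (fun U W => b.orthogonal U ⊔ W = ⊤) ∧
    φ = elementaryProd hs ha x.1 (x.2.1 : Module.End k V)

/-- Equal products have equal constant coefficients, hence equal first subspaces. Properness rules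
out an empty list against a nonempty one, since the empty list gives image `⊤`. -/
theorem IsFactorization.unique {φ : Module.End k[T;T⁻¹] (LaurentModule k V)}
    {x y : List (Submodule k V) × unitaryGroup b}
    (hx : IsFactorization hs ha φ x) (hy : IsFactorization hs ha φ y) : x = y := by
  obtain ⟨l, h⟩ := x
  obtain ⟨l', h'⟩ := y
  induction l generalizing l' φ with
  | nil =>
    obtain ⟨-, hc, rfl⟩ := hx
    obtain ⟨hn', hc', he⟩ := hy
    have hr := range_laurentCoeff_elementaryProd hs ha hc h
    dsimp only at he hn' hc'
    rw [he, range_laurentCoeff_elementaryProd hs ha hc'] at hr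
    cases l' with
    | nil =>
      rw [elementaryProd_nil, elementaryProd_nil] at he
      rw [Subtype.ext (LinearEquiv.toLinearMap_injective (constEnd_injective he))]
    | cons U l' => exact absurd hr (hn' U List.mem_cons_self)
  | cons U l ih =>
    obtain ⟨hn, hc, rfl⟩ := hx
    obtain ⟨hn', hc', he⟩ := hy
    have hr := range_laurentCoeff_elementaryProd hs ha hc h
    dsimp only at he hn hn' hc hc'
    rw [he, range_laurentCoeff_elementaryProd hs ha hc'] at hr
    cases l' with
    | nil => exact absurd hr.symm (hn U List.mem_cons_self)
    | cons W l' =>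
      obtain rfl : W = U := hr
      rw [elementaryProd_cons, elementaryProd_cons] at he
      have he' := congrArg (elementaryInv hs ha W * ·) he
      simp only [elementaryInv_mul_elementary_mul] at he'
      have := ih (φ := elementaryProd hs ha l (h.1 : Module.End k V)) ⟨fun U hU => hn U (List.mem_cons_of_mem _ hU), hc.tail, rfl⟩ l'
        ⟨fun U hU => hn' U (List.mem_cons_of_mem _ hU), hc'.tail, he'⟩
      rw [Prod.mk.injEq] at this ⊢
      exact ⟨congrArg _ this.1, this.2⟩

theorem PreservesForm.exists_isFactorization {m : ℕ}
    {φ : Module.End k[T;T⁻¹] (LaurentModule k V)} (hφ : PreservesForm b φ)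
    (hm : ∀ i, i ∉ Finset.Icc (-m : ℤ) 0 → laurentCoeff φ i = 0) :
    ∃ x, IsFactorization hs ha φ x := by
  induction m generalizing φ with
  | zero =>
    have hiso := hφ.lowest hm
    simp only [Nat.cast_zero, neg_zero, if_true] at hiso
    -- An isometry of an anisotropic form is injective, hence bijective in finite dimension.
    have hinj : Function.Injective (laurentCoeff φ 0) := by
      refine (injective_iff_map_eq_zero _).2 fun v hv => (ha v).1 ?_
      rw [← hiso, hv, map_zero]
    refine ⟨([], ⟨LinearEquiv.ofInjectiveEndo _ hinj, hiso⟩), by simp, by simp, ?_⟩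
    rw [elementaryProd_nil]
    refine laurentCoeff_ext fun i => ?_
    rw [laurentCoeff_constEnd]
    split_ifs with hi
    · subst hi; ext v; rfl
    · exact hm i (by rw [Finset.mem_Icc]; push_cast; omega)
  | succ m ih =>
    have hlow : ∀ v w, b (laurentCoeff φ 0 v) (laurentCoeff φ (-(m + 1 : ℕ)) w) = 0 := fun v w => by
      rw [hφ.lowest hm, if_neg m.succ_ne_zero]
    set U := LinearMap.range (laurentCoeff φ 0) with hU
    have hrange : projOrthogonal hs ha U * laurentCoeff φ 0 = 0 := by
      ext v
      exact Submodule.projection_apply_of_mem_right _ (LinearMap.mem_range_self _ v)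
    have hker : proj hs ha U * laurentCoeff φ (-(m + 1 : ℕ)) = 0 := by
      ext w
      refine Submodule.projection_apply_of_mem_right _ ?_
      rintro _ ⟨v, rfl⟩
      exact hlow v w
    have hψ : ∀ i, i ∉ Finset.Icc (-m : ℤ) 0 →
        laurentCoeff (elementaryInv hs ha U * φ) i = 0 := by
      intro i hi
      rw [Finset.mem_Icc] at hi
      rw [laurentCoeff_elementaryInv_mul]
      -- Only `i = 1` is not covered by the support of `φ`: there `π_{U*} φ₀ = 0` because `U = im
      -- φ₀`.
      have h1 : projOrthogonal hs ha U * laurentCoeff φ (i - 1) = 0 := by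
        by_cases hi1 : i = 1
        · rw [hi1, sub_self, hrange]
        · rw [hm _ (by rw [Finset.mem_Icc]; push_cast; omega), mul_zero]
      -- Only `i = -(m + 1)` is not covered: there the image of the lowest coefficient lies in `U*`.
      have h2 : proj hs ha U * laurentCoeff φ i = 0 := by
        by_cases him : i = -(m + 1 : ℕ)
        · rw [him, hker]
        · rw [hm _ (by rw [Finset.mem_Icc]; push_cast at him ⊢; omega), mul_zero]
      rw [h1, h2, add_zero]
    have hφψ := elementary_mul_elementaryInv_mul hs ha U φ
    have hpos : ∀ i : ℤ, 0 < i → laurentCoeff (elementaryInv hs ha U * φ) i = 0 := fun i hi =>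
      hψ i (by rw [Finset.mem_Icc]; omega)
    have hmap := range_laurentCoeff_elementary_mul_zero hs ha U hpos
    -- Since `U = im φ₀ = π_U (im ψ₀)` for `ψ = p_U⁻¹ φ`, this is the chain condition between `U`
    -- and the next subspace.
    rw [hφψ, ← hU, eq_comm, proj_map_eq_self_iff] at hmap
    obtain ⟨⟨l, h⟩, hn, hc, he⟩ := ih ((preservesForm_elementaryInv hs ha U).mul hφ) hψ
    -- If `U = V`, no proper factor splits off, but `π_U = 1` forces the lowest coefficient of `φ`
    -- to vanish, so induction applies to `φ` itself.
    by_cases hUtop : U = ⊤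
    · refine ih hφ fun i hi => ?_
      have hproj : proj hs ha U = 1 := by
        ext v
        exact Submodule.projection_apply_of_mem_left _ (hUtop ▸ Submodule.mem_top)
      by_cases him : i = -(m + 1 : ℕ)
      · rw [him, ← hker, hproj, one_mul]
      · exact hm _ (by rw [Finset.mem_Icc] at hi ⊢; push_cast at him ⊢; omega)
    · refine ⟨(U :: l, h), ?_, ?_, ?_⟩
      · simpa [hUtop] using hn
      · refine List.isChain_cons.2 ⟨fun W hW => ?_, hc⟩
        dsimp only at he hc
        rw [he, range_laurentCoeff_elementaryProd hs ha hc] at hmap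
        rwa [List.headD_eq_head?_getD, Option.mem_def.1 hW] at hmap
      · rw [elementaryProd_cons, ← he, hφψ]

/-- The images of a finite basis involve only finitely many powers of `t`; this supplies the `m` for
the induction. -/
theorem exists_laurentCoeff_eq_zero_of_lt (φ : Module.End k[T;T⁻¹] (LaurentModule k V)) :
    ∃ m : ℕ, ∀ i : ℤ, i < -m → laurentCoeff φ i = 0 := by
  let e := Module.finBasis k V
  let s : Finset ℤ := Finset.univ.biUnion fun j => (coord k V (φ (1 ⊗ₜ e j))).support
  obtain ⟨c, hc⟩ := s.bddBelow
  refine ⟨c.natAbs, fun i hi => e.ext fun j => ?_⟩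
  rw [laurentCoeff_apply, LinearMap.zero_apply]
  by_contra h
  have : i ∈ s := Finset.mem_biUnion.2 ⟨j, Finset.mem_univ j, Finsupp.mem_support_iff.2 h⟩
  have := hc this
  omega

end Paraunitary

end

theorem mainTheorem5 {k V : Type*} [Field k] [AddCommGroup V] [Module k V] [FiniteDimensional k V]
    (b : LinearMap.BilinForm k V) (hs : b.IsSymm) (ha : Paraunitary.IsAnisotropic b)
    (p : Paraunitary.paraunitaryGroup b) (hp : p ∈ Paraunitary.paraunitaryNeg b) :
    ∃! x : List (Submodule k V) × Paraunitary.unitaryGroup b,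
      (∀ U ∈ x.1, U ≠ ⊤) ∧
      x.1.IsChain (fun U W => b.orthogonal U ⊔ W = ⊤) ∧
      (p.1 : Module.End k[T;T⁻¹] (Paraunitary.LaurentModule k V)) =
        (x.1.map (Paraunitary.elementary hs ha)).prod *
          Paraunitary.constEnd (x.2.1 : Module.End k V) := by
  obtain ⟨m, hm⟩ := Paraunitary.exists_laurentCoeff_eq_zero_of_lt
    (p.1 : Module.End k[T;T⁻¹] (Paraunitary.LaurentModule k V))
  have hform : Paraunitary.PreservesForm b
    (p.1 : Module.End k[T;T⁻¹] (Paraunitary.LaurentModule k V)) := p.2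
  obtain ⟨x, hx⟩ := hform.exists_isFactorization hs ha (m := m) fun i hi => by
    rw [Finset.mem_Icc, not_and_or, not_le, not_le] at hi
    exact hi.elim (hm i) (hp i)
  exact ⟨x, hx, fun y hy => Paraunitary.IsFactorization.unique hs ha hy hx⟩
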